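/- **Setting.** An instance of online bin packing is a finite sequence $\sigma$ of items with sizes in $(0,1]$, which arrive one by one and are packed irrevocably into bins of capacity $1$. $\mathrm{Opt}(\sigma)$ is the least number of bins into which $\sigma$ can be packed, the level of a bin is the total size of its items, and an item is large if its size exceeds $1/2$ and small otherwise. The (asymptotic) competitive ratio of an algorithm $A$ is $\limsup_{n\to\infty}\sup\{A(\sigma)/\mathrm{Opt}(\sigma) : \mathrm{Opt}(\sigma)=n\}$, where $A(\sigma)$ is the number of bins that $A$ opens. Best Fit among a set of bins means: choose a bin of highest level among those that have enough space for the item; ties are broken arbitrarily. **Algorithm.** Refined Harmonic Match (RHM) uses $K=19$ classes: for $1\le i\le 18$, class $i$ is $(\frac1{i+2},\frac1{i+1}]\cup(\frac i{i+1},\frac{i+1}{i+2}]$, and class $19$ is $(0,\frac1{20}]\cup(\frac{19}{20},1]$. Some bins are called mature. An item $x$ of a class $k\ge2$ is packed as follows. If $x$ is large, a new bin is opened for it. If $x$ is small, it is put by Best Fit into a mature bin; if this is impossible, it is put by Best Fit into a bin that contains only a single large item of class $k$, and this bin becomes mature; if this is impossible too, it is put into the current Next Fit bin of class $k$ if it fits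 there, and otherwise that bin (if there is one) becomes mature and a new Next Fit bin of class $k$ is opened for $x$. The items of class $1$, that is of $(1/3,2/3]$, are packed by Refined Relaxed Online Match (RRM) without using mature bins. Put $a=(\frac13,\frac{37}{96}]$, $b=(\frac{37}{96},\frac12]$, $c=(\frac12,\frac{59}{96}]$, $d=(\frac{59}{96},\frac23]$. A bin that has received two items of class $1$ is mature. A bin opened for an $a$ item is designated either as an $a_1$-bin (to receive a $c$ item) or as an $a_2$-bin (to receive another $a$ item). Red bins are those with two $a$ items and the $a_2$-bins with a single $a$ item; blue bins are those with a $c$ item and an $a$ or $b$ item, and the $a_1$-bins with a single $a$ item. - A $d$ item opens a new bin. - A $c$ item is put by Best Fit into an $a_1$-bin with a single $a$ item, and otherwise opens a new bin. - A $b$ item is put by Best Fit into a bin with a single $c$ item; otherwise into a bin with a single $b$ item; otherwise it opens a new bin. - An $a$ item is put by Best Fit into a bin with a single $d$ item; otherwise into a bin with a single $c$ item; otherwise into an $a_2$-bin with a single $a$ item; otherwise it opens a new bin, which is designated as an $a_2$-bin if the number of red bins is less than three times the number of blue bins, and as an $a_1$-bin if not. **Theorem 3.** The asymptotic competitive ratio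 of RHM is at most $\frac{373}{228}<1.636$, however ties are broken. More precisely, there is a constant $C$ such that, for every tie-breaking rule and every instance $\sigma$, $$\mathrm{RHM}(\sigma)\le\tfrac{373}{228}\,\mathrm{Opt}(\sigma)+C .$$ -/

import Mathlib

/-- An instance of online bin packing: a finite sequence of items with sizes in `(0, 1]`. -/
def IsInstance (σ : List ℝ) : Prop := ∀ x ∈ σ, 0 < x ∧ x ≤ 1

/-- The items of `σ` can be packed into `m` bins of capacity `1`. -/
def Packable (σ : List ℝ) (m : ℕ) : Prop :=
  ∃ f : Fin σ.length → Fin m, ∀ j : Fin m, ∑ i with f i = j, σ.get i ≤ 1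

/-- The optimal offline cost: the least number of unit bins into which `σ` can be packed. -/
noncomputable def opt (σ : List ℝ) : ℕ := sInf {m | Packable σ m}

/-- The asymptotic competitive ratio of an algorithm that uses `A σ` bins on the sequence `σ`:
the limit superior, as `n → ∞`, of the largest ratio `A σ / opt σ` over the instances `σ` whose
optimal cost is `n`. -/
noncomputable def asymptoticRatio (A : List ℝ → ℕ) : ENNReal :=
  Filter.limsup
    (fun n : ℕ => ⨆ σ : List ℝ, ⨆ _ : IsInstance σ ∧ opt σ = n, (A σ : ENNReal) / (opt σ : ENNReal))
    Filter.atTop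

/-- `x` belongs to class `i` of the Harmonic Match classification with parameter `K`. -/
def InClass (K i : ℕ) (x : ℝ) : Prop :=
  (1 ≤ i ∧ i < K ∧
    (x ∈ Set.Ioc (1 / (i + 2) : ℝ) (1 / (i + 1)) ∨
      x ∈ Set.Ioc (i / (i + 1) : ℝ) ((i + 1) / (i + 2)))) ∨
  (i = K ∧ (x ∈ Set.Ioc (0 : ℝ) (1 / (K + 1)) ∨ x ∈ Set.Ioc (K / (K + 1) : ℝ) 1))

/-- The class of `x` (every `x ∈ (0, 1]` lies in exactly one class). -/
noncomputable def classOf (K : ℕ) (x : ℝ) : ℕ := sInf {i | InClass K i x}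

/-- The types of bins in a packing of Refined Harmonic Match. -/
inductive Kind
  /-- a single `d` item -/
  | d
  /-- a single `c` item -/
  | c
  /-- a single `b` item -/
  | b
  /-- a single `a` item, designated to receive a `c` item -/
  | a₁
  /-- a single `a` item, designated to receive another `a` item -/
  | a₂
  /-- mature: a `d` item and an `a` item -/
  | ad
  /-- mature: a `c` item and an `a` item -/
  | ac
  /-- mature: a `c` item and a `b` item -/
  | bc
  /-- mature: two `b` items -/
  | bb
  /-- mature: two `a` items -/
  | aa
  /-- normal: a single large item of class `k ≥ 2` -/
  | large (k : ℕ)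
  /-- normal: the current Next Fit bin for the small items of class `k ≥ 2` -/
  | nextFit (k : ℕ)
  /-- mature: a bin closed by the treatment of some class `k ≥ 2` -/
  | closed

/-- The mature bins. -/
def Kind.IsMature : Kind → Prop
  | .ad | .ac | .bc | .bb | .aa | .closed => True
  | _ => False

/-- The red bins. -/
def Kind.isRed : Kind → Bool
  | .aa | .a₂ => true
  | _ => false

/-- The blue bins. -/
def Kind.isBlue : Kind → Bool
  | .ac | .bc | .a₁ => true
  | _ => false

/-- A bin: the items placed in it, and its type. -/
structure Bin where
  items : List ℝ
  kind : Kind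

/-- The level of a bin is the total size of its items. -/
noncomputable def Bin.level (B : Bin) : ℝ := B.items.sum

/-- The (indices of the) bins whose type satisfies `P` and which have enough space for `x`. The bins
of a packing are listed in the order in which they were opened. -/
noncomputable def fitting (s : List Bin) (x : ℝ) (P : Kind → Prop) : Finset (Fin s.length) :=
  open Classical in {i | P (s.get i).kind ∧ (s.get i).level + x ≤ 1}

/-- The fitting bins of the highest level. -/
noncomputable def bestFitting (s : List Bin) (x : ℝ) (P : Kind → Prop) : Finset (Fin s.length) :=
  open Classical in {i ∈ fitting s x P | ∀ j ∈ fitting s x P, (s.get j).level ≤ (s.get i).level}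

/-- A tie-breaking rule for Best Fit picks one bin among equally good ones. It may depend on the
current packing and on the item. -/
structure TieBreak where
  pick : (s : List Bin) → ℝ → (C : Finset (Fin s.length)) → C.Nonempty → Fin s.length
  pick_mem : ∀ s x C hC, pick s x C hC ∈ C

/-- For example, ties can be broken in favour of the bin that was opened first. -/
instance : Nonempty TieBreak :=
  ⟨⟨fun _ _ C hC => C.min' hC, fun _ _ C hC => C.min'_mem hC⟩⟩

open Classical in
/-- The Best Fit choice among the bins whose type satisfies `P`; `none` if `x` fits in none. -/
noncomputable def bestFit (τ : TieBreak) (s : List Bin) (x : ℝ) (P : Kind → Prop) :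
    Option (Fin s.length) :=
  if hC : (bestFitting s x P).Nonempty then some (τ.pick s x (bestFitting s x P) hC) else none

/-- Open a new bin of type `k` for `x`. -/
def openBin (s : List Bin) (x : ℝ) (k : Kind) : List Bin := s ++ [⟨[x], k⟩]

/-- Put `x` into the `i`-th bin, and update the type of the bin by `g`. -/
def put (s : List Bin) (i : ℕ) (x : ℝ) (g : Kind → Kind) : List Bin :=
  s.modify i fun B => ⟨B.items ++ [x], g B.kind⟩

open Classical in
/-- Declare the current Next Fit bin of class `k`, if there is one, as mature. -/
noncomputable def closeNextFit (s : List Bin) (k : ℕ) : List Bin :=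
  s.map fun B => if B.kind = .nextFit k then ⟨B.items, .closed⟩ else B

/-- The Harmonic Match strategy for an item `x` of class `k`. -/
noncomputable def hmStep (τ : TieBreak) (k : ℕ) (s : List Bin) (x : ℝ) : List Bin :=
  if 1 / 2 < x then openBin s x (.large k)
  else
    match bestFit τ s x Kind.IsMature with
    | some i => put s i x id
    | none =>
      match bestFit τ s x (· = .large k) with
      | some i => put s i x fun _ => .closed
      | none =>
        match bestFit τ s x (· = .nextFit k) with
        | some i => put s i x id
        | none => openBin (closeNextFit s k) x (.nextFit k)

/-- The Refined Relaxed Online Match strategy for an item `x ∈ (1/3, 2/3]`. -/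
noncomputable def rrmStep (τ : TieBreak) (s : List Bin) (x : ℝ) : List Bin :=
  if 59 / 96 < x then
    -- a `d` item
    openBin s x .d
  else if 1 / 2 < x then
    -- a `c` item
    match bestFit τ s x (· = .a₁) with
    | some i => put s i x fun _ => .ac
    | none => openBin s x .c
  else if 37 / 96 < x then
    -- a `b` item
    match bestFit τ s x (· = .c) with
    | some i => put s i x fun _ => .bc
    | none =>
      match bestFit τ s x (· = .b) with
      | some i => put s i x fun _ => .bb
      | none => openBin s x .b
  else
    -- an `a` item
    match bestFit τ s x (· = .d) with
    | some i => put s i x fun _ => .ad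
    | none =>
      match bestFit τ s x (· = .c) with
      | some i => put s i x fun _ => .ac
      | none =>
        match bestFit τ s x (· = .a₂) with
        | some i => put s i x fun _ => .aa
        | none =>
          if s.countP (fun B => B.kind.isRed) < 3 * s.countP (fun B => B.kind.isBlue) then
            openBin s x .a₂
          else openBin s x .a₁

/-- One step of Refined Harmonic Match, which uses the classes of Harmonic Match with `K = 19`. -/
noncomputable def rhmStep (τ : TieBreak) (s : List Bin) (x : ℝ) : List Bin :=
  if classOf 19 x = 1 then rrmStep τ s x else hmStep τ (classOf 19 x) s x

/-- The packing of the sequence `σ` by Refined Harmonic Match. -/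
noncomputable def rhmPacking (τ : TieBreak) (σ : List ℝ) : List Bin := σ.foldl (rhmStep τ) []

/-- The cost of Refined Harmonic Match: the number of bins that it opens. -/
noncomputable def rhm (τ : TieBreak) (σ : List ℝ) : ℕ := (rhmPacking τ σ).length

/-! The proof is a weighting argument with two free parameters: `α` for `a` items and `γ` for `c`
items. On the offline side, every set of items that fits into one bin weighs at most 373/228 as long
as `α ≤ 4/7`, `γ ≤ 1` and `α + γ ≤ 10/7` (`sum_weight_le`), so the total weight is at most 373/228
times `opt σ`. The extremal bin is an item of weight 1 just above 1/2, one just above 1/4, one just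
above 1/5, and sand: 1 + 1/3 + 1/4 + (20/19)(1/20) = 373/228.

On the online side, the bins must have average weight at least 1, up to a constant. Bins closed by
the Harmonic part, and bins containing a large item above 59/96, weigh at least 1 for every
admissible choice of weights. The class 1 bins do so only on average: blue bins may compensate for
red ones or the reverse, and the ratio 3 between them is what the algorithm maintains
(`BalancedBins`). Lone `c` bins and lone `a₁`-bins never coexist, because an `a` and a `c` item
always fit together (37/96 + 59/96 = 1).

The weights are chosen after the final packing is known. Without lone `a₁`-bins take `α = 3/7`, `γ =
1`: the bound red ≤ 3·blue lets the surplus of blue bins pay for the deficit of red ones. Otherwise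
there are no lone `c` bins, so `c` items can be made light: take `α = 4/7`, `γ = 1/14`, and 3·blue ≤
red + 3 lets red bins pay for blue ones. Since `Invariant` is proved for all nonnegative `α` and
`γ`, one induction over the input serves both cases.

The Best Fit rule matters only in that the chosen bin has the prescribed type, and that no choice
means no bin of that type has space. Hence ties are irrelevant. -/

/-- The weight of an item, where `α` is the weight of `a` items and `γ` that of `c` items. -/
noncomputable def weight (α γ x : ℝ) : ℝ :=
  if 59 / 96 < x then 1
  else if 1 / 2 < x then γ
  else if 37 / 96 < x then 1 / 2
  else if 1 / 3 < x then α
  else if 1 / 20 < x then 1 / (⌊1 / x⌋₊ : ℝ)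
  else 20 / 19 * x

/-! ### Weights, and the maximal weight of a bin of capacity 1. -/

section Weight

variable {α γ x : ℝ}

theorem weight_of_gt (hx : 59 / 96 < x) : weight α γ x = 1 := by
  simp [weight, hx]

theorem weight_of_c (h₁ : 1 / 2 < x) (h₂ : x ≤ 59 / 96) : weight α γ x = γ := by
  rw [weight, if_neg (by linarith), if_pos h₁]

theorem weight_of_b (h₁ : 37 / 96 < x) (h₂ : x ≤ 1 / 2) : weight α γ x = 1 / 2 := by
  rw [weight, if_neg (by linarith), if_neg (by linarith), if_pos h₁]

theorem weight_of_a (h₁ : 1 / 3 < x) (h₂ : x ≤ 37 / 96) : weight α γ x = α := by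
  rw [weight, if_neg (by linarith), if_neg (by linarith), if_neg (by linarith), if_pos h₁]

theorem weight_of_le_third (h₂ : x ≤ 1 / 3) :
    weight α γ x = if 1 / 20 < x then 1 / (⌊1 / x⌋₊ : ℝ) else 20 / 19 * x := by
  rw [weight, if_neg (by linarith), if_neg (by linarith), if_neg (by linarith),
    if_neg (by linarith)]

theorem weight_of_le_twentieth (h₂ : x ≤ 1 / 20) : weight α γ x = 20 / 19 * x := by
  rw [weight_of_le_third (by linarith), if_neg (by linarith)]

theorem weight_harmonic {n : ℕ} (hn : 3 ≤ n) (hn' : n ≤ 19) (h₁ : 1 / (n + 1 : ℝ) < x)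
    (h₂ : x ≤ 1 / n) : weight α γ x = 1 / n := by
  have hn0 : (3 : ℝ) ≤ n := by exact_mod_cast hn
  have hn1 : (n : ℝ) ≤ 19 := by exact_mod_cast hn'
  have hx : 0 < x := lt_trans (by positivity) h₁
  have h20 : 1 / 20 < x := lt_of_le_of_lt (by
    apply one_div_le_one_div_of_le <;> linarith) h₁
  have h3 : x ≤ 1 / 3 := h₂.trans (one_div_le_one_div_of_le (by norm_num) hn0)
  have hf : ⌊1 / x⌋₊ = n := by
    rw [Nat.floor_eq_iff (by positivity)]
    constructor
    · rw [le_div_iff₀ hx]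
      rw [le_div_iff₀ (by linarith)] at h₂
      linarith
    · rw [div_lt_iff₀ hx]
      rw [div_lt_iff₀ (by linarith)] at h₁
      linarith
  rw [weight_of_le_third h3, if_pos h20, hf]

theorem weight_nonneg (hα : 0 ≤ α) (hγ : 0 ≤ γ) (hx : 0 < x) : 0 ≤ weight α γ x := by
  unfold weight
  split_ifs <;> first | assumption | positivity

/-- With `n = ⌊1/x⌋`, raising `x` to `1/n` inflates it by a factor below `(n + 1)/n`, which
decreases in `n ≥ m`. Sand has density 20/19, at most `(m + 1)/m` since `m ≤ 19`. -/
theorem weight_le_mul {m : ℕ} (hm : 3 ≤ m) (hm' : m ≤ 19) (hx : 0 < x) (hxm : x ≤ 1 / m) :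
    weight α γ x ≤ (m + 1) / m * x := by
  have hm0 : (3 : ℝ) ≤ m := by exact_mod_cast hm
  have hm1 : (m : ℝ) ≤ 19 := by exact_mod_cast hm'
  have h3 : x ≤ 1 / 3 := hxm.trans (one_div_le_one_div_of_le (by norm_num) hm0)
  rw [weight_of_le_third h3]
  split_ifs with h
  · have hmf : m ≤ ⌊1 / x⌋₊ := by
      apply Nat.le_floor
      rw [le_div_iff₀ hx]
      rw [le_div_iff₀ (by linarith)] at hxm
      linarith
    have hlt := Nat.lt_floor_add_one (1 / x)
    set n := ⌊1 / x⌋₊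
    have hmn : (m : ℝ) ≤ n := by exact_mod_cast hmf
    rw [div_lt_iff₀ hx] at hlt
    have hn0 : (0 : ℝ) < n := by linarith
    have hmp : (0 : ℝ) < m := by linarith
    rw [div_mul_eq_mul_div, div_le_div_iff₀ hn0 hmp]
    have : (m : ℝ) ≤ m * ((n + 1) * x) := by nlinarith
    nlinarith [mul_nonneg (sub_nonneg.2 hmn) hx.le]
  · gcongr ?_ * x
    rw [div_le_div_iff₀ (by norm_num) (by linarith)]
    linarith

theorem sum_weight_le_mul {m : ℕ} (hm : 3 ≤ m) (hm' : m ≤ 19) (M : Multiset ℝ)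
    (hM : ∀ x ∈ M, 0 < x ∧ x ≤ 1 / m) :
    (M.map (weight α γ)).sum ≤ (m + 1) / m * M.sum := by
  have h : (m + 1 : ℝ) / m * M.sum = (M.map fun x => (m + 1 : ℝ) / m * x).sum := by
    rw [Multiset.sum_map_mul_left, Multiset.map_id']
  rw [h]
  exact Multiset.sum_map_le_sum_map _ _ fun x hx => weight_le_mul hm hm' (hM x hx).1 (hM x hx).2

theorem multiset_sum_pos_nonneg {M : Multiset ℝ} (hM : ∀ x ∈ M, 0 < x) : 0 ≤ M.sum :=
  Multiset.sum_nonneg fun x hx => (hM x hx).le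

theorem le_sum_of_mem_of_pos {M : Multiset ℝ} (hM : ∀ x ∈ M, 0 < x) (hx : x ∈ M) : x ≤ M.sum :=
  Multiset.single_le_sum (fun y hy => (hM y hy).le) x hx

/-- The weight of small items that fit together with a `c` item. -/
theorem sum_weight_le_of_sum_lt_half (M : Multiset ℝ) (hpos : ∀ x ∈ M, 0 < x)
    (h3 : ∀ x ∈ M, x ≤ 1 / 3) (hM : M.sum < 1 / 2) :
    (M.map (weight α γ)).sum ≤ 145 / 228 := by
  by_cases h4 : ∃ x ∈ M, 1 / 4 < x
  · obtain ⟨x, hx, hx4⟩ := h4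
    have hxw : weight α γ x = 1 / 3 := by
      have := weight_harmonic (α := α) (γ := γ) (n := 3) (x := x) le_rfl (by norm_num)
        (by norm_num; linarith) (by push_cast; exact h3 x hx)
      simpa using this
    obtain ⟨N, rfl⟩ := Multiset.exists_cons_of_mem hx
    simp only [Multiset.mem_cons, forall_eq_or_imp] at hpos h3
    simp only [Multiset.sum_cons, Multiset.map_cons] at hM ⊢
    rw [hxw]
    by_cases h5 : ∃ y ∈ N, 1 / 5 < y
    · obtain ⟨y, hy, hy5⟩ := h5
      have hyN := le_sum_of_mem_of_pos hpos.2 hy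
      have hyw : weight α γ y = 1 / 4 := by
        have := weight_harmonic (α := α) (γ := γ) (n := 4) (x := y) (by norm_num) (by norm_num)
          (by norm_num; linarith) (by push_cast; linarith)
        simpa using this
      obtain ⟨L, rfl⟩ := Multiset.exists_cons_of_mem hy
      simp only [Multiset.mem_cons, forall_eq_or_imp] at hpos h3
      simp only [Multiset.sum_cons, Multiset.map_cons] at hM ⊢
      rw [hyw]
      -- The rest has size below 1/2 - 1/4 - 1/5 = 1/20. This is the extremal case: 1/3 + 1/4 +
      -- (20/19)(1/20) = 145/228.
      have := sum_weight_le_mul (α := α) (γ := γ) (m := 19) (by norm_num) le_rfl L fun z hz =>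
        ⟨hpos.2.2 z hz, by
          have := le_sum_of_mem_of_pos hpos.2.2 hz
          norm_num; linarith⟩
      norm_num at this
      linarith
    -- Here the bound is 1/3 + (6/5)(1/4) = 19/30 < 145/228.
    · push Not at h5
      have := sum_weight_le_mul (α := α) (γ := γ) (m := 5) (by norm_num) (by norm_num) N
        fun z hz => ⟨hpos.2 z hz, by exact_mod_cast h5 z hz⟩
      norm_num at this
      linarith
  -- Density 5/4 on size below 1/2 gives 5/8 < 145/228.
  · push Not at h4
    have := sum_weight_le_mul (α := α) (γ := γ) (m := 4) (by norm_num) (by norm_num) M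
      fun z hz => ⟨hpos z hz, by exact_mod_cast h4 z hz⟩
    norm_num at this
    linarith

/-- The weight of the items of a bin that contains no item of size more than `1 / 2`. -/
theorem sum_weight_le_of_le_half (hα : α ≤ 4 / 7) (M : Multiset ℝ)
    (hpos : ∀ x ∈ M, 0 < x) (hM : M.sum ≤ 1) (h2 : ∀ x ∈ M, x ≤ 1 / 2) :
    (M.map (weight α γ)).sum ≤ 373 / 228 := by
  have small (N : Multiset ℝ) (h : ∀ x ∈ N, 0 < x) (h3 : ∀ x ∈ N, x ≤ 1 / 3) :
      (N.map (weight α γ)).sum ≤ 4 / 3 * N.sum := by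
    have := sum_weight_le_mul (α := α) (γ := γ) (m := 3) le_rfl (by norm_num) N
      fun z hz => ⟨h z hz, by exact_mod_cast h3 z hz⟩
    norm_num at this
    exact this
  have mid (x : ℝ) (h₁ : 1 / 3 < x) (h₂ : x ≤ 1 / 2) : weight α γ x ≤ 4 / 7 := by
    rcases le_or_gt x (37 / 96) with h | h
    · rwa [weight_of_a h₁ h]
    · rw [weight_of_b h h₂]; norm_num
  by_cases h3 : ∃ x ∈ M, 1 / 3 < x
  · obtain ⟨x, hx, hx3⟩ := h3
    obtain ⟨N, rfl⟩ := Multiset.exists_cons_of_mem hx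
    simp only [Multiset.mem_cons, forall_eq_or_imp] at hpos h2
    simp only [Multiset.sum_cons, Multiset.map_cons] at hM ⊢
    have hwx := mid x hx3 h2.1
    by_cases h3 : ∃ y ∈ N, 1 / 3 < y
    · obtain ⟨y, hy, hy3⟩ := h3
      obtain ⟨L, rfl⟩ := Multiset.exists_cons_of_mem hy
      simp only [Multiset.mem_cons, forall_eq_or_imp] at hpos h2
      simp only [Multiset.sum_cons, Multiset.map_cons] at hM ⊢
      have hwy := mid y hy3 h2.2.1
      -- Two items above 1/3 leave less than 1/3, so no third one fits: 8/7 + (4/3)(1/3) < 373/228.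
      have := small L hpos.2.2 fun z hz => by
        have := le_sum_of_mem_of_pos hpos.2.2 hz
        linarith
      linarith
    · push Not at h3
      have := small N hpos.2 h3
      linarith
  · push Not at h3
    have := small M hpos h3
    linarith

/-- The items of a bin of capacity `1` have total weight at most `373 / 228`. -/
theorem sum_weight_le (hα : α ≤ 4 / 7) (hγ : γ ≤ 1)
    (hαγ : α + γ ≤ 10 / 7) (M : Multiset ℝ) (hpos : ∀ x ∈ M, 0 < x) (hM : M.sum ≤ 1) :
    (M.map (weight α γ)).sum ≤ 373 / 228 := by
  by_cases h2 : ∃ x ∈ M, 1 / 2 < x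
  swap
  · push Not at h2
    exact sum_weight_le_of_le_half hα M hpos hM h2
  obtain ⟨x, hx, hx2⟩ := h2
  obtain ⟨N, rfl⟩ := Multiset.exists_cons_of_mem hx
  simp only [Multiset.mem_cons, forall_eq_or_imp] at hpos
  simp only [Multiset.sum_cons, Multiset.map_cons] at hM ⊢
  have small (m : ℕ) (hm : 3 ≤ m) (hm' : m ≤ 19) (L : Multiset ℝ) (h : ∀ x ∈ L, 0 < x)
      (h3 : ∀ x ∈ L, x ≤ 1 / m) := sum_weight_le_mul (α := α) (γ := γ) hm hm' L
      fun z hz => ⟨h z hz, h3 z hz⟩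
  rcases le_or_gt x (59 / 96) with hx' | hx'
  · rw [weight_of_c hx2 hx']
    by_cases h3 : ∃ y ∈ N, 1 / 3 < y
    · obtain ⟨y, hy, hy3⟩ := h3
      obtain ⟨L, rfl⟩ := Multiset.exists_cons_of_mem hy
      simp only [Multiset.mem_cons, forall_eq_or_imp] at hpos
      simp only [Multiset.sum_cons, Multiset.map_cons] at hM ⊢
      have hL := multiset_sum_pos_nonneg hpos.2.2
      rcases le_or_gt y (37 / 96) with hy' | hy'
      · rw [weight_of_a hy3 hy']
        -- The rest is below 1 - 1/2 - 1/3 = 1/6: 10/7 + (7/6)(1/6) < 373/228.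
        have := small 6 (by norm_num) (by norm_num) L hpos.2.2 fun z hz => by
          have := le_sum_of_mem_of_pos hpos.2.2 hz
          norm_num; linarith
        norm_num at this
        linarith
      · rw [weight_of_b hy' (by linarith)]
        -- The rest is below 1 - 1/2 - 37/96 = 11/96 < 1/8: 3/2 + (9/8)(11/96) < 373/228.
        have := small 8 (by norm_num) (by norm_num) L hpos.2.2 fun z hz => by
          have := le_sum_of_mem_of_pos hpos.2.2 hz
          norm_num; linarith
        norm_num at this
        linarith
    · push Not at h3
      have := sum_weight_le_of_sum_lt_half (α := α) (γ := γ) N hpos.2 h3 (by linarith)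
      linarith
  · rw [weight_of_gt hx']
    by_cases h3 : ∃ y ∈ N, 1 / 3 < y
    · obtain ⟨y, hy, hy3⟩ := h3
      obtain ⟨L, rfl⟩ := Multiset.exists_cons_of_mem hy
      simp only [Multiset.mem_cons, forall_eq_or_imp] at hpos
      simp only [Multiset.sum_cons, Multiset.map_cons] at hM ⊢
      have hL := multiset_sum_pos_nonneg hpos.2.2
      rw [weight_of_a hy3 (by linarith)]
      -- The rest is below 1 - 59/96 - 1/3 = 5/96, just under 1/19: 11/7 + (20/19)(5/96) < 373/228.
      have := small 19 (by norm_num) le_rfl L hpos.2.2 fun z hz => by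
        have := le_sum_of_mem_of_pos hpos.2.2 hz
        norm_num; linarith
      norm_num at this
      linarith
    · push Not at h3
      have := small 3 le_rfl (by norm_num) N hpos.2 fun z hz => by exact_mod_cast h3 z hz
      norm_num at this
      linarith

end Weight

/-! ### Comparison of the total weight with the offline optimum. -/

theorem packable_length {σ : List ℝ} (hσ : IsInstance σ) : Packable σ σ.length := by
  refine ⟨id, fun j => ?_⟩
  rw [Finset.sum_filter]
  simpa using (hσ _ (List.get_mem σ j)).2

theorem packable_opt {σ : List ℝ} (hσ : IsInstance σ) : Packable σ (opt σ) :=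
  Nat.sInf_mem (s := {m | Packable σ m}) ⟨_, packable_length hσ⟩

/-- The total weight of an instance is at most `373 / 228` times the optimal cost. -/
theorem sum_weight_le_opt {α γ : ℝ} (hα : α ≤ 4 / 7) (hγ : γ ≤ 1)
    (hαγ : α + γ ≤ 10 / 7) {σ : List ℝ} (hσ : IsInstance σ) :
    (σ.map (weight α γ)).sum ≤ 373 / 228 * (opt σ : ℝ) := by
  obtain ⟨f, hf⟩ := packable_opt hσ
  have h : (σ.map (weight α γ)).sum = ∑ i : Fin σ.length, weight α γ (σ.get i) := by
    rw [← List.sum_ofFn]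
    congr 1
    conv_lhs => rw [← List.ofFn_get σ, List.map_ofFn]
    rfl
  rw [h, ← Finset.sum_fiberwise Finset.univ f]
  calc _ ≤ ∑ _j : Fin (opt σ), (373 / 228 : ℝ) := by
        refine Finset.sum_le_sum fun j _ => ?_
        have := sum_weight_le hα hγ hαγ
          ((Finset.univ.filter fun i => f i = j).val.map σ.get) (fun x hx => by
            obtain ⟨i, -, rfl⟩ := Multiset.mem_map.1 hx
            exact (hσ _ (List.get_mem σ i)).1) (hf j)
        rw [Multiset.map_map] at this
        exact this
    _ = _ := by simp [mul_comm]

/-! ### The Harmonic Match classes. -/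

theorem exists_inClass {x : ℝ} (h0 : 0 < x) (h1 : x ≤ 1) : ∃ k, InClass 19 k x := by
  rcases le_or_gt x (1 / 20) with h | h
  · exact ⟨19, Or.inr ⟨rfl, Or.inl ⟨h0, by norm_num; linarith⟩⟩⟩
  rcases lt_or_ge (19 / 20) x with h' | h'
  · exact ⟨19, Or.inr ⟨rfl, Or.inr ⟨by norm_num; linarith, h1⟩⟩⟩
  rcases le_or_gt x (1 / 2) with h2 | h2
  -- For a small item the class is `⌊1/x⌋ - 1`; for a large one it is `⌈1/(1 - x)⌉ - 2`.
  · have hle : 2 ≤ ⌊1 / x⌋₊ := Nat.le_floor (by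
      rw [le_div_iff₀ h0]; push_cast; linarith)
    have hfl : (⌊1 / x⌋₊ : ℝ) ≤ 1 / x := Nat.floor_le (by positivity)
    have hlt : 1 / x < ⌊1 / x⌋₊ + 1 := Nat.lt_floor_add_one _
    have hub : ⌊1 / x⌋₊ < 20 := by
      rw [Nat.floor_lt (by positivity), div_lt_iff₀ h0]; push_cast; linarith
    obtain ⟨i, hi⟩ : ∃ i, ⌊1 / x⌋₊ = i + 1 := ⟨⌊1 / x⌋₊ - 1, by omega⟩
    rw [hi] at hle hub hlt hfl
    push_cast at hlt hfl
    refine ⟨i, Or.inl ⟨by omega, by omega, Or.inl ⟨?_, ?_⟩⟩⟩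
    · rw [div_lt_iff₀ h0] at hlt
      rw [div_lt_iff₀ (by positivity)]
      linarith
    · rw [le_div_iff₀ h0] at hfl
      rw [le_div_iff₀ (by positivity)]
      linarith
  · have hy : 0 < 1 - x := by linarith
    have hle : 1 / (1 - x) ≤ ⌈1 / (1 - x)⌉₊ := Nat.le_ceil _
    have hlt : (⌈1 / (1 - x)⌉₊ : ℝ) < 1 / (1 - x) + 1 := Nat.ceil_lt_add_one (by positivity)
    have hlb : 2 < ⌈1 / (1 - x)⌉₊ := by
      rw [Nat.lt_ceil, lt_div_iff₀ hy]; push_cast; linarith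
    have hub : ⌈1 / (1 - x)⌉₊ ≤ 20 := by
      rw [Nat.ceil_le, div_le_iff₀ hy]; push_cast; linarith
    obtain ⟨i, hi⟩ : ∃ i, ⌈1 / (1 - x)⌉₊ = i + 2 := ⟨⌈1 / (1 - x)⌉₊ - 2, by omega⟩
    rw [hi] at hle hub hlt hlb
    push_cast at hlt hle
    refine ⟨i, Or.inl ⟨by omega, by omega, Or.inr ⟨?_, ?_⟩⟩⟩
    · have hlt' : (i : ℝ) + 1 < 1 / (1 - x) := by linarith
      rw [lt_div_iff₀ hy] at hlt'
      rw [div_lt_iff₀ (by positivity)]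
      linarith
    · rw [div_le_iff₀ hy] at hle
      rw [le_div_iff₀ (by positivity)]
      linarith

theorem inClass_classOf {x : ℝ} (h0 : 0 < x) (h1 : x ≤ 1) : InClass 19 (classOf 19 x) x :=
  Nat.sInf_mem (s := {i | InClass 19 i x}) (exists_inClass h0 h1)

theorem InClass.mem_of_one {x : ℝ} (h : InClass 19 1 x) : 1 / 3 < x ∧ x ≤ 2 / 3 := by
  rcases h with ⟨-, -, h | h⟩ | ⟨h, -⟩
  · norm_num at h
    exact ⟨by linarith, by linarith⟩
  · norm_num at h
    exact ⟨by linarith, by linarith⟩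
  · norm_num at h

theorem InClass.pos {k : ℕ} {x : ℝ} (h : InClass 19 k x) : 1 ≤ k ∧ k ≤ 19 := by
  rcases h with ⟨h, h', -⟩ | ⟨h, -⟩ <;> omega

/-- Small items of the classes `k ≥ 2`. -/
theorem InClass.small {k : ℕ} {x : ℝ} (h : InClass 19 k x) (hk : 2 ≤ k) (hx : x ≤ 1 / 2) :
    (k < 19 ∧ 1 / (k + 2 : ℝ) < x ∧ x ≤ 1 / (k + 1)) ∨ (k = 19 ∧ 0 < x ∧ x ≤ 1 / 20) := by
  rcases h with ⟨-, h', h | h⟩ | ⟨rfl, h | h⟩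
  · exact Or.inl ⟨h', h.1, h.2⟩
  · exfalso
    have h := h.1
    have hk' : (2 : ℝ) ≤ k := by exact_mod_cast hk
    rw [div_lt_iff₀ (by positivity)] at h
    nlinarith
  · norm_num at h
    exact Or.inr ⟨rfl, h.1, by linarith⟩
  · norm_num at h
    linarith

/-- Large items of the classes `k ≥ 2`. -/
theorem InClass.large {k : ℕ} {x : ℝ} (h : InClass 19 k x) (hk : 2 ≤ k) (hx : 1 / 2 < x) :
    2 / 3 < x := by
  have hk' : (2 : ℝ) ≤ k := by exact_mod_cast hk
  rcases h with ⟨-, h', h | h⟩ | ⟨rfl, h | h⟩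
  · have h := h.2
    rw [le_div_iff₀ (by positivity)] at h
    nlinarith
  · have h := h.1
    rw [div_lt_iff₀ (by positivity)] at h
    nlinarith
  · norm_num at h
    linarith
  · norm_num at h
    linarith

/-! ### Bin counts and the invariant. -/

/-- The bins with a single `c` item. -/
def Kind.isC : Kind → Bool
  | .c => true
  | _ => false

/-- The bins with a single `b` item. -/
def Kind.isB : Kind → Bool
  | .b => true
  | _ => false

/-- The `a₁`-bins with a single `a` item. -/
def Kind.isA₁ : Kind → Bool
  | .a₁ => true
  | _ => false

/-- The `a₂`-bins with a single `a` item. -/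
def Kind.isA₂ : Kind → Bool
  | .a₂ => true
  | _ => false

/-- The Next Fit bins of class `k`. -/
def Kind.isNextFit (k : ℕ) : Kind → Bool
  | .nextFit j => j == k
  | _ => false

/-- The number of bins of the types selected by `p`. -/
def numBins (p : Kind → Bool) (s : List Bin) : ℕ := s.countP fun B => p B.kind

section NumBins

variable (p : Kind → Bool)

theorem numBins_nil : numBins p [] = 0 := rfl

theorem numBins_append (s t : List Bin) : numBins p (s ++ t) = numBins p s + numBins p t :=
  List.countP_append

theorem numBins_cons (B : Bin) (s : List Bin) :
    numBins p (B :: s) = numBins p s + if p B.kind then 1 else 0 :=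
  List.countP_cons

theorem numBins_eq_zero {p : Kind → Bool} {s : List Bin} (h : ∀ B ∈ s, p B.kind = false) :
    numBins p s = 0 := by
  simpa [numBins, List.countP_eq_zero] using h

end NumBins

/-- The total weight of the items of a bin. -/
noncomputable def Bin.weight (α γ : ℝ) (B : Bin) : ℝ := (B.items.map (_root_.weight α γ)).sum

/-- What the type of a bin says about its items. -/
def Bin.Sound (α γ : ℝ) (B : Bin) : Prop :=
  match B.kind with
  | .c => ∃ x, B.items = [x] ∧ 1 / 2 < x ∧ x ≤ 59 / 96
  | .b => ∃ x, B.items = [x] ∧ 37 / 96 < x ∧ x ≤ 1 / 2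
  | .a₁ | .a₂ => ∃ x, B.items = [x] ∧ 1 / 3 < x ∧ x ≤ 37 / 96
  | .d | .ad | .bb | .large _ | .closed => 1 ≤ B.weight α γ
  | .ac => α + γ ≤ B.weight α γ
  | .bc => γ + 1 / 2 ≤ B.weight α γ
  | .aa => 2 * α ≤ B.weight α γ
  | .nextFit k => 2 ≤ k ∧ k ≤ 19 ∧ ∀ x ∈ B.items, InClass 19 k x ∧ x ≤ 1 / 2

/-- The numbers of bins of the various types that Refined Harmonic Match maintains. -/
structure BalancedBins (s : List Bin) : Prop where
  c_or_a₁ : numBins Kind.isC s = 0 ∨ numBins Kind.isA₁ s = 0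
  red_le : numBins Kind.isRed s ≤ 3 * numBins Kind.isBlue s
  -- An `a₁`-bin is opened only when red ≥ 3·blue, hence the slack 3. While a lone `a₁`-bin is
  -- present there are no lone `c` bins, so the blue count can then grow only by opening another
  -- `a₁`-bin.
  blue_le : numBins Kind.isA₁ s = 0 ∨ 3 * numBins Kind.isBlue s ≤ numBins Kind.isRed s + 3
  b_le : numBins Kind.isB s ≤ 1
  a₂_le : numBins Kind.isA₂ s ≤ 1
  nextFit_le : ∀ k, numBins (Kind.isNextFit k) s ≤ 1

/-- The invariant of Refined Harmonic Match; `t` is the total weight of the items packed. -/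
structure Invariant (α γ t : ℝ) (s : List Bin) : Prop where
  sound : ∀ B ∈ s, B.Sound α γ
  balanced : BalancedBins s
  total : (s.map (Bin.weight α γ)).sum = t

/-! ### The Best Fit choice. -/

theorem mem_fitting {s : List Bin} {x : ℝ} {P : Kind → Prop} {i : Fin s.length} :
    i ∈ fitting s x P ↔ P (s.get i).kind ∧ (s.get i).level + x ≤ 1 := by
  classical simp [fitting]

theorem mem_bestFitting {s : List Bin} {x : ℝ} {P : Kind → Prop} {i : Fin s.length} :
    i ∈ bestFitting s x P ↔
      i ∈ fitting s x P ∧ ∀ j ∈ fitting s x P, (s.get j).level ≤ (s.get i).level := by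
  classical simp [bestFitting]

theorem bestFitting_nonempty {s : List Bin} {x : ℝ} {P : Kind → Prop}
    (h : (fitting s x P).Nonempty) : (bestFitting s x P).Nonempty := by
  obtain ⟨i, hi, hmax⟩ := Finset.exists_max_image (fitting s x P) (fun i => (s.get i).level) h
  exact ⟨i, mem_bestFitting.2 ⟨hi, hmax⟩⟩

theorem lt_of_bestFit_eq_none {τ : TieBreak} {s : List Bin} {x : ℝ} {P : Kind → Prop}
    (h : bestFit τ s x P = none) : ∀ B ∈ s, P B.kind → 1 < B.level + x := by
  intro B hB hP
  by_contra hlt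
  obtain ⟨i, rfl⟩ := List.get_of_mem hB
  have hne : (bestFitting s x P).Nonempty :=
    bestFitting_nonempty ⟨i, mem_fitting.2 ⟨hP, not_lt.1 hlt⟩⟩
  simp [bestFit, hne] at h

theorem exists_of_bestFit_eq_some {τ : TieBreak} {s : List Bin} {x : ℝ} {P : Kind → Prop}
    {i : Fin s.length} (h : bestFit τ s x P = some i) :
    ∃ l₁ B l₂, s = l₁ ++ B :: l₂ ∧ P B.kind ∧
      ∀ g, put s i x g = l₁ ++ ⟨B.items ++ [x], g B.kind⟩ :: l₂ := by
  have hi : i ∈ fitting s x P := by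
    unfold bestFit at h
    split_ifs at h with hne
    have hmem := τ.pick_mem s x _ hne
    rw [Option.some.inj h] at hmem
    exact (mem_bestFitting.1 hmem).1
  have hP : P (s.get i).kind := (mem_fitting.1 hi).1
  refine ⟨s.take i, s.get i, s.drop (i + 1), ?_, hP, fun g => ?_⟩
  · simp
  · rw [put, List.modify_eq_take_cons_drop i.2]
    rfl

/-! ### Preservation of the invariant by the Harmonic Match step. -/

section Weight

variable {α γ t x : ℝ} {s : List Bin} {B : Bin}

theorem Bin.weight_mk (l : List ℝ) (k : Kind) :
    Bin.weight α γ ⟨l, k⟩ = (l.map (_root_.weight α γ)).sum := rfl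

theorem Bin.weight_put (B : Bin) (x : ℝ) (k : Kind) :
    Bin.weight α γ ⟨B.items ++ [x], k⟩ = B.weight α γ + _root_.weight α γ x := by
  simp [Bin.weight]

theorem Invariant.openBin {k : Kind} (h : Invariant α γ t s) (hB : Bin.Sound α γ ⟨[x], k⟩)
    (hbal : BalancedBins (s ++ [⟨[x], k⟩])) :
    Invariant α γ (t + _root_.weight α γ x) (openBin s x k) where
  sound := by
    simp only [_root_.openBin, List.mem_append, List.mem_singleton]
    rintro C (hC | rfl)
    exacts [h.sound C hC, hB]
  balanced := hbal
  total := by simp [_root_.openBin, h.total, Bin.weight]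

theorem Invariant.put {l₁ l₂ : List Bin} {k : Kind} (h : Invariant α γ t (l₁ ++ B :: l₂))
    (hB : Bin.Sound α γ B → Bin.Sound α γ ⟨B.items ++ [x], k⟩)
    (hbal : BalancedBins (l₁ ++ ⟨B.items ++ [x], k⟩ :: l₂)) :
    Invariant α γ (t + _root_.weight α γ x) (l₁ ++ ⟨B.items ++ [x], k⟩ :: l₂) where
  sound := by
    have hs := h.sound
    simp only [List.mem_append, List.mem_cons] at hs ⊢
    rintro C (hC | rfl | hC)
    exacts [hs C (Or.inl hC), hB (hs B (Or.inr (Or.inl rfl))), hs C (Or.inr (Or.inr hC))]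
  balanced := hbal
  total := by
    have ht := h.total
    simp only [List.map_append, List.map_cons, List.sum_append, List.sum_cons,
      Bin.weight_put] at ht ⊢
    linarith

/-- For mature types soundness is only a lower bound on the weight, so further items do no harm. -/
theorem Bin.Sound.put_mature (hx : 0 ≤ _root_.weight α γ x) (hB : B.Sound α γ)
    (hk : B.kind.IsMature) : Bin.Sound α γ ⟨B.items ++ [x], B.kind⟩ := by
  obtain ⟨l, k⟩ := B
  have hw := Bin.weight_put (α := α) (γ := γ) ⟨l, k⟩ x k
  cases k <;> simp only [Kind.IsMature] at hk <;> simp only [Bin.Sound] at hB ⊢ <;> linarith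

theorem BalancedBins.put_same {l₁ l₂ : List Bin} (h : BalancedBins (l₁ ++ B :: l₂)) :
    BalancedBins (l₁ ++ ⟨B.items ++ [x], B.kind⟩ :: l₂) := by
  have hn (p : Kind → Bool) : numBins p (l₁ ++ ⟨B.items ++ [x], B.kind⟩ :: l₂) =
      numBins p (l₁ ++ B :: l₂) := by
    simp only [numBins_append, numBins_cons]
  constructor <;> simp only [hn]
  exacts [h.c_or_a₁, h.red_le, h.blue_le, h.b_le, h.a₂_le, h.nextFit_le]

/-- A bin of small items of class `k ≥ 2` is full when it does not have space for another one. -/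
theorem one_le_sum_weight {k : ℕ} (hk : 2 ≤ k) {l : List ℝ}
    (hl : ∀ y ∈ l, InClass 19 k y ∧ y ≤ 1 / 2) (hx : InClass 19 k x) (hx2 : x ≤ 1 / 2)
    (h : 1 < l.sum + x) : 1 ≤ (l.map (_root_.weight α γ)).sum := by
  rcases hx.small hk hx2 with ⟨hk', -, hx⟩ | ⟨rfl, -, hx⟩
  · have hl' : ∀ y ∈ l, _root_.weight α γ y = 1 / (k + 1) ∧ y ≤ 1 / (k + 1) := by
      intro y hy
      rcases (hl y hy).1.small hk (hl y hy).2 with ⟨-, h₁, h₂⟩ | ⟨h, -⟩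
      · refine ⟨?_, h₂⟩
        have := weight_harmonic (α := α) (γ := γ) (n := k + 1) (x := y) (by omega) (by omega)
          (by push_cast; convert h₁ using 2; ring) (by push_cast; exact h₂)
        exact_mod_cast this
      · omega
    have hw : (l.map (_root_.weight α γ)).sum = l.length * (1 / (k + 1)) := by
      rw [List.map_congr_left fun y hy => (hl' y hy).1]
      simp
    have hs : l.sum ≤ l.length * (1 / (k + 1)) := by
      have := List.sum_le_card_nsmul l _ fun y hy => (hl' y hy).2
      simpa using this
    have hk0 : (0 : ℝ) < k + 1 := by positivity
    rw [hw, mul_one_div, le_div_iff₀ hk0]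
    -- The rejected item also has size at most `1/(k + 1)`, so the bin together with it holds more
    -- than `k + 1` items; by integrality the bin alone holds at least `k + 1`, each of weight `1/(k
    -- + 1)`.
    have hlt : (1 : ℝ) < l.length / (k + 1) + 1 / (k + 1) := by
      rw [mul_one_div] at hs; linarith
    rw [← add_div, lt_div_iff₀ hk0] at hlt
    have : k + 1 < l.length + 1 := by exact_mod_cast (by linarith : (k + 1 : ℝ) < l.length + 1)
    have : k + 1 ≤ l.length := by omega
    have : (k + 1 : ℝ) ≤ l.length := by exact_mod_cast this
    linarith
  · have hl' : ∀ y ∈ l, _root_.weight α γ y = 20 / 19 * y := by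
      intro y hy
      rcases (hl y hy).1.small hk (hl y hy).2 with ⟨h, -⟩ | ⟨-, -, h₂⟩
      · omega
      · exact weight_of_le_twentieth h₂
    have hw : (l.map (_root_.weight α γ)).sum = 20 / 19 * l.sum := by
      rw [List.map_congr_left hl', List.sum_map_mul_left, List.map_id']
    -- A bin rejecting an item of size at most 1/20 has level above 19/20, which is what the density
    -- 20/19 compensates.
    rw [hw]
    linarith

/-- The bin is closed because it rejected an item of its own class, so its weight has reached 1 and
the soundness condition of `closed` holds. -/
theorem Invariant.closeNextFit {k : ℕ} (h : Invariant α γ t s) (hk : 2 ≤ k)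
    (hx : InClass 19 k x) (hx2 : x ≤ 1 / 2)
    (hfull : ∀ B ∈ s, B.kind = .nextFit k → 1 < B.level + x) :
    Invariant α γ t (_root_.closeNextFit s k) ∧
      numBins (Kind.isNextFit k) (_root_.closeNextFit s k) = 0 := by
  have hn (p : Kind → Bool) (hp : p .closed = p (.nextFit k)) :
      numBins p (_root_.closeNextFit s k) = numBins p s := by
    rw [numBins, numBins, _root_.closeNextFit, List.countP_map]
    congr 1
    funext B
    simp only [Function.comp]
    split_ifs with hB
    · simp [hB, hp]
    · rfl
  have h0 : numBins (Kind.isNextFit k) (_root_.closeNextFit s k) = 0 := by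
    apply numBins_eq_zero
    intro B hB
    simp only [_root_.closeNextFit, List.mem_map] at hB
    obtain ⟨C, -, rfl⟩ := hB
    split_ifs with hC
    · rfl
    · generalize C.kind = j at hC
      cases j <;> simp_all [Kind.isNextFit]
  refine ⟨⟨?_, ?_, ?_⟩, h0⟩
  · intro B hB
    simp only [_root_.closeNextFit, List.mem_map] at hB
    obtain ⟨C, hC, rfl⟩ := hB
    split_ifs with hCk
    · have hCs := h.sound C hC
      simp only [Bin.Sound, hCk] at hCs
      exact one_le_sum_weight hk hCs.2.2 hx hx2 (hfull C hC hCk)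
    · exact h.sound C hC
  · have hb := h.balanced
    refine ⟨?_, ?_, ?_, ?_, ?_, fun j => ?_⟩
    · rw [hn _ rfl, hn _ rfl]; exact hb.c_or_a₁
    · rw [hn _ rfl, hn _ rfl]; exact hb.red_le
    · rw [hn _ rfl, hn _ rfl, hn _ rfl]; exact hb.blue_le
    · rw [hn _ rfl]; exact hb.b_le
    · rw [hn _ rfl]; exact hb.a₂_le
    · by_cases hj : k = j
      · subst hj; omega
      · rw [hn _ (by simp [Kind.isNextFit, hj])]; exact hb.nextFit_le j
  · rw [← h.total, _root_.closeNextFit, List.map_map]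
    congr 2
    funext B
    simp only [Function.comp]
    split_ifs <;> rfl

theorem Invariant.hmStep (τ : TieBreak) {k : ℕ} (h : Invariant α γ t s) (hk : 2 ≤ k)
    (hx : InClass 19 k x) (hw : 0 ≤ _root_.weight α γ x) :
    Invariant α γ (t + _root_.weight α γ x) (hmStep τ k s x) := by
  unfold _root_.hmStep
  split_ifs with hx2
  · refine h.openBin ?_ ?_
    · have := hx.large hk hx2
      simp only [Bin.Sound, Bin.weight_mk, List.map_cons, List.map_nil, List.sum_cons, List.sum_nil]
      rw [weight_of_gt (by linarith)]
      norm_num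
    · obtain ⟨h₁, h₂, h₃, h₄, h₅, h₆⟩ := h.balanced
      constructor <;> simpa [numBins_append, numBins_cons, numBins_nil, Kind.isC, Kind.isA₁,
        Kind.isA₂, Kind.isB, Kind.isRed, Kind.isBlue, Kind.isNextFit]
  rw [not_lt] at hx2
  split
  · rename_i i hi
    obtain ⟨l₁, B, l₂, rfl, hB, hput⟩ := exists_of_bestFit_eq_some hi
    rw [hput]
    exact h.put (fun hs => hs.put_mature hw hB) h.balanced.put_same
  split
  · rename_i i hi
    obtain ⟨l₁, ⟨l, j⟩, l₂, rfl, rfl, hput⟩ := exists_of_bestFit_eq_some hi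
    rw [hput]
    refine h.put (fun hs => ?_) ?_
    · simp only [Bin.Sound, Bin.weight_mk, List.map_append, List.sum_append, List.map_cons,
        List.map_nil, List.sum_cons, List.sum_nil] at hs ⊢
      linarith
    · obtain ⟨h₁, h₂, h₃, h₄, h₅, h₆⟩ := h.balanced
      simp [numBins_append, numBins_cons, Kind.isC, Kind.isA₁,
        Kind.isA₂, Kind.isB, Kind.isRed, Kind.isBlue, Kind.isNextFit] at h₁ h₂ h₃ h₄ h₅ h₆
      constructor <;> simp [numBins_append, numBins_cons, Kind.isC, Kind.isA₁,
        Kind.isA₂, Kind.isB, Kind.isRed, Kind.isBlue, Kind.isNextFit]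
      case nextFit_le => exact h₆
      all_goals omega
  split
  · rename_i i hi
    obtain ⟨l₁, B, l₂, rfl, hB, hput⟩ := exists_of_bestFit_eq_some hi
    rw [hput]
    refine h.put (fun hs => ?_) h.balanced.put_same
    obtain ⟨l, j⟩ := B
    subst hB
    simp only [Bin.Sound, List.mem_append, List.mem_singleton, id] at hs ⊢
    refine ⟨hs.1, hs.2.1, ?_⟩
    rintro y (hy | rfl)
    exacts [hs.2.2 y hy, ⟨hx, hx2⟩]
  · rename_i hnf
    obtain ⟨hinv, h0⟩ := h.closeNextFit hk hx hx2 (lt_of_bestFit_eq_none hnf)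
    refine hinv.openBin ?_ ?_
    · simpa [Bin.Sound] using ⟨hk, hx.pos.2, hx, by linarith⟩
    · obtain ⟨h₁, h₂, h₃, h₄, h₅, h₆⟩ := hinv.balanced
      refine ⟨?_, ?_, ?_, ?_, ?_, fun j => ?_⟩
      case refine_6 =>
        have := h₆ j
        simp only [numBins_append, numBins_cons, numBins_nil, Kind.isNextFit]
        by_cases hj : k = j
        · subst hj; simp [h0]
        · simpa [hj]
      all_goals simpa [numBins_append, numBins_cons, numBins_nil, Kind.isC, Kind.isA₁,
        Kind.isA₂, Kind.isB, Kind.isRed, Kind.isBlue, Kind.isNextFit]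

/-! ### Preservation of the invariant by the class 1 step. -/

theorem Bin.Sound.level_le_of_isC (hB : B.Sound α γ) (hk : B.kind = .c) :
    B.level ≤ 59 / 96 := by
  simp only [Bin.Sound, hk] at hB
  obtain ⟨y, hy, -, h⟩ := hB
  simpa [Bin.level, hy] using h

theorem Bin.Sound.level_le_of_isB (hB : B.Sound α γ) (hk : B.kind = .b) :
    B.level ≤ 1 / 2 := by
  simp only [Bin.Sound, hk] at hB
  obtain ⟨y, hy, -, h⟩ := hB
  simpa [Bin.level, hy] using h

theorem Bin.Sound.level_le_of_isA₁ (hB : B.Sound α γ) (hk : B.kind = .a₁) :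
    B.level ≤ 37 / 96 := by
  simp only [Bin.Sound, hk] at hB
  obtain ⟨y, hy, -, h⟩ := hB
  simpa [Bin.level, hy] using h

theorem Bin.Sound.level_le_of_isA₂ (hB : B.Sound α γ) (hk : B.kind = .a₂) :
    B.level ≤ 37 / 96 := by
  simp only [Bin.Sound, hk] at hB
  obtain ⟨y, hy, -, h⟩ := hB
  simpa [Bin.level, hy] using h

/-- If an item fits into no bin of type `k`, although it fits together with every item that such a
bin can contain, then there is no such bin. -/
theorem Invariant.numBins_eq_zero {τ : TieBreak} {k : Kind} {p : Kind → Bool} {c : ℝ}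
    (h : Invariant α γ t s) (hp : ∀ j, p j = true → j = k)
    (hc : ∀ B : Bin, B.Sound α γ → B.kind = k → B.level ≤ c) (hx : c + x ≤ 1)
    (hbf : bestFit τ s x (· = k) = none) : numBins p s = 0 := by
  apply _root_.numBins_eq_zero
  intro B hB
  by_contra hpB
  have hk := hp _ (by simpa using hpB)
  have h₁ := lt_of_bestFit_eq_none hbf B hB hk
  have h₂ := hc B (h.sound B hB) hk
  linarith

/-- The thresholds make the pairs `a`–`c`, `b`–`b` and `a`–`a` always fit. Hence a new lone `c`, `b`
or `a` bin is opened only when no lone bin of a compatible type is present, which gives the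
exclusion of lone `c` against lone `a₁`-bins and the bounds by 1. -/
theorem Invariant.rrmStep (τ : TieBreak) (h : Invariant α γ t s) (hx : 1 / 3 < x)
    (hα : 0 ≤ α) :
    Invariant α γ (t + _root_.weight α γ x) (rrmStep τ s x) := by
  obtain ⟨h₁, h₂, h₃, h₄, h₅, h₆⟩ := h.balanced
  unfold _root_.rrmStep
  by_cases hd : 59 / 96 < x
  on_goal 2 => by_cases hc : 1 / 2 < x
  on_goal 3 => by_cases hb : 37 / 96 < x
  · rw [if_pos hd]
    refine h.openBin ?_ ?_
    · simp [Bin.Sound, Bin.weight_mk, weight_of_gt hd]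
    · constructor <;> simpa [numBins_append, numBins_cons, numBins_nil, Kind.isC, Kind.isA₁,
        Kind.isA₂, Kind.isB, Kind.isRed, Kind.isBlue, Kind.isNextFit]
  · rw [if_neg hd, if_pos hc]
    rw [not_lt] at hd
    have hw := weight_of_c (α := α) (γ := γ) hc hd
    split
    · rename_i i hi
      obtain ⟨l₁, ⟨l, j⟩, l₂, rfl, rfl, hput⟩ := exists_of_bestFit_eq_some hi
      rw [hput]
      refine h.put (fun hs => ?_) ?_
      · obtain ⟨y, hy, hy₁, hy₂⟩ := hs
        simp only at hy
        simp [Bin.Sound, Bin.weight_mk, hy, weight_of_a hy₁ hy₂, hw]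
      · simp [numBins_append, numBins_cons, Kind.isC, Kind.isA₁,
          Kind.isA₂, Kind.isB, Kind.isRed, Kind.isBlue, Kind.isNextFit] at h₁ h₂ h₃ h₄ h₅ h₆
        constructor <;> simp [numBins_append, numBins_cons, Kind.isC, Kind.isA₁,
          Kind.isA₂, Kind.isB, Kind.isRed, Kind.isBlue, Kind.isNextFit]
        case nextFit_le => exact h₆
        all_goals omega
    · rename_i hn
      have h0 := h.numBins_eq_zero (p := Kind.isA₁) (c := 37 / 96)
        (by intro j; cases j <;> simp [Kind.isA₁])
        (fun B => Bin.Sound.level_le_of_isA₁) (by linarith) hn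
      refine h.openBin ⟨x, rfl, hc, hd⟩ ?_
      constructor <;> simp [numBins_append, numBins_cons, numBins_nil, Kind.isC, Kind.isA₁,
          Kind.isA₂, Kind.isB, Kind.isRed, Kind.isBlue, Kind.isNextFit]
      case nextFit_le => exact h₆
      all_goals omega
  · rw [if_neg hd, if_neg hc, if_pos hb]
    rw [not_lt] at hc
    have hw := weight_of_b (α := α) (γ := γ) hb hc
    split
    · rename_i i hi
      obtain ⟨l₁, ⟨l, j⟩, l₂, rfl, rfl, hput⟩ := exists_of_bestFit_eq_some hi
      rw [hput]
      refine h.put (fun hs => ?_) ?_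
      · obtain ⟨y, hy, hy₁, hy₂⟩ := hs
        simp only at hy
        simp [Bin.Sound, Bin.weight_mk, hy, weight_of_c hy₁ hy₂, hw]
      · simp [numBins_append, numBins_cons, Kind.isC, Kind.isA₁,
          Kind.isA₂, Kind.isB, Kind.isRed, Kind.isBlue, Kind.isNextFit] at h₁ h₂ h₃ h₄ h₅ h₆
        constructor <;> simp [numBins_append, numBins_cons, Kind.isC, Kind.isA₁,
          Kind.isA₂, Kind.isB, Kind.isRed, Kind.isBlue, Kind.isNextFit]
        case nextFit_le => exact h₆
        all_goals omega
    split
    · rename_i i hi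
      obtain ⟨l₁, ⟨l, j⟩, l₂, rfl, rfl, hput⟩ := exists_of_bestFit_eq_some hi
      rw [hput]
      refine h.put (fun hs => ?_) ?_
      · obtain ⟨y, hy, hy₁, hy₂⟩ := hs
        simp only at hy
        norm_num [Bin.Sound, Bin.weight_mk, hy, weight_of_b hy₁ hy₂, hw]
      · simp [numBins_append, numBins_cons, Kind.isC, Kind.isA₁,
          Kind.isA₂, Kind.isB, Kind.isRed, Kind.isBlue, Kind.isNextFit] at h₁ h₂ h₃ h₄ h₅ h₆
        constructor <;> simp [numBins_append, numBins_cons, Kind.isC, Kind.isA₁,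
          Kind.isA₂, Kind.isB, Kind.isRed, Kind.isBlue, Kind.isNextFit]
        case nextFit_le => exact h₆
        all_goals omega
    · rename_i hn
      have h0 := h.numBins_eq_zero (p := Kind.isB) (c := 1 / 2)
        (by intro j; cases j <;> simp [Kind.isB])
        (fun B => Bin.Sound.level_le_of_isB) (by linarith) hn
      refine h.openBin ⟨x, rfl, hb, hc⟩ ?_
      constructor <;> simp [numBins_append, numBins_cons, numBins_nil, Kind.isC, Kind.isA₁,
          Kind.isA₂, Kind.isB, Kind.isRed, Kind.isBlue, Kind.isNextFit]
      case nextFit_le => exact h₆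
      all_goals omega
  · rw [if_neg hd, if_neg hc, if_neg hb]
    rw [not_lt] at hb
    have hw := weight_of_a (α := α) (γ := γ) hx hb
    split
    · rename_i i hi
      obtain ⟨l₁, ⟨l, j⟩, l₂, rfl, rfl, hput⟩ := exists_of_bestFit_eq_some hi
      rw [hput]
      refine h.put (fun hs => ?_) ?_
      · simp only [Bin.Sound, Bin.weight_mk, List.map_append, List.sum_append, List.map_cons,
          List.map_nil, List.sum_cons, List.sum_nil] at hs ⊢
        linarith
      · simp [numBins_append, numBins_cons, Kind.isC, Kind.isA₁,
          Kind.isA₂, Kind.isB, Kind.isRed, Kind.isBlue, Kind.isNextFit] at h₁ h₂ h₃ h₄ h₅ h₆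
        constructor <;> simp [numBins_append, numBins_cons, Kind.isC, Kind.isA₁,
          Kind.isA₂, Kind.isB, Kind.isRed, Kind.isBlue, Kind.isNextFit]
        case nextFit_le => exact h₆
        all_goals omega
    split
    · rename_i i hi
      obtain ⟨l₁, ⟨l, j⟩, l₂, rfl, rfl, hput⟩ := exists_of_bestFit_eq_some hi
      rw [hput]
      refine h.put (fun hs => ?_) ?_
      · obtain ⟨y, hy, hy₁, hy₂⟩ := hs
        simp only at hy
        simp [Bin.Sound, Bin.weight_mk, hy, weight_of_c hy₁ hy₂, hw, add_comm]
      · simp [numBins_append, numBins_cons, Kind.isC, Kind.isA₁,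
          Kind.isA₂, Kind.isB, Kind.isRed, Kind.isBlue, Kind.isNextFit] at h₁ h₂ h₃ h₄ h₅ h₆
        constructor <;> simp [numBins_append, numBins_cons, Kind.isC, Kind.isA₁,
          Kind.isA₂, Kind.isB, Kind.isRed, Kind.isBlue, Kind.isNextFit]
        case nextFit_le => exact h₆
        all_goals omega
    rename_i hn
    have hC := h.numBins_eq_zero (p := Kind.isC) (c := 59 / 96)
      (by intro j; cases j <;> simp [Kind.isC])
      (fun B => Bin.Sound.level_le_of_isC) (by linarith) hn
    split
    · rename_i i hi
      obtain ⟨l₁, ⟨l, j⟩, l₂, rfl, rfl, hput⟩ := exists_of_bestFit_eq_some hi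
      rw [hput]
      refine h.put (fun hs => ?_) ?_
      · obtain ⟨y, hy, hy₁, hy₂⟩ := hs
        simp only at hy
        simp [Bin.Sound, Bin.weight_mk, hy, weight_of_a hy₁ hy₂, hw, two_mul]
      · simp [numBins_append, numBins_cons, Kind.isC, Kind.isA₁,
          Kind.isA₂, Kind.isB, Kind.isRed, Kind.isBlue, Kind.isNextFit] at h₁ h₂ h₃ h₄ h₅ h₆
        constructor <;> simp [numBins_append, numBins_cons, Kind.isC, Kind.isA₁,
          Kind.isA₂, Kind.isB, Kind.isRed, Kind.isBlue, Kind.isNextFit]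
        case nextFit_le => exact h₆
        all_goals omega
    rename_i hn
    have hA := h.numBins_eq_zero (p := Kind.isA₂) (c := 37 / 96)
      (by intro j; cases j <;> simp [Kind.isA₂])
      (fun B => Bin.Sound.level_le_of_isA₂) (by linarith) hn
    change Invariant α γ _
      (if numBins Kind.isRed s < 3 * numBins Kind.isBlue s then _ else _)
    split_ifs with hrb
    all_goals
      refine h.openBin ⟨x, rfl, hx, hb⟩ ?_
      constructor <;> simp [numBins_append, numBins_cons, numBins_nil, Kind.isC, Kind.isA₁,
          Kind.isA₂, Kind.isB, Kind.isRed, Kind.isBlue, Kind.isNextFit]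
      case nextFit_le => exact h₆
      all_goals omega

end Weight

/-! ### The invariant of the whole packing, and the count of its bins. -/

theorem BalancedBins.nil : BalancedBins [] := by
  constructor <;> simp [numBins_nil]

theorem invariant_rhmPacking {α γ : ℝ} (hα : 0 ≤ α) (hγ : 0 ≤ γ) (τ : TieBreak) {σ : List ℝ}
    (hσ : IsInstance σ) : Invariant α γ (σ.map (weight α γ)).sum (rhmPacking τ σ) := by
  induction σ using List.reverseRecOn with
  | nil => exact ⟨by simp [rhmPacking], BalancedBins.nil, by simp [rhmPacking]⟩
  | append_singleton σ x ih =>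
    have ih := ih fun y hy => hσ y (by simp [hy])
    obtain ⟨h0, h1⟩ := hσ x (by simp)
    have hcl := inClass_classOf h0 h1
    have e : rhmPacking τ (σ ++ [x]) = rhmStep τ (rhmPacking τ σ) x := by
      simp [rhmPacking, List.foldl_append]
    rw [e, List.map_append, List.sum_append, List.map_singleton, List.sum_singleton, rhmStep]
    split_ifs with hk
    · rw [hk] at hcl
      exact ih.rrmStep τ hcl.mem_of_one.1 hα
    · have := hcl.pos
      exact ih.hmStep τ (by omega) hcl (weight_nonneg hα hγ h0)

theorem Bin.Sound.weight_nonneg {α γ : ℝ} (hα : 0 ≤ α) (hγ : 0 ≤ γ) {B : Bin}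
    (h : B.Sound α γ) : 0 ≤ B.weight α γ := by
  obtain ⟨l, k⟩ := B
  cases k with
  | c =>
    obtain ⟨x, hx, h₁, h₂⟩ := h
    simp only at hx
    simp [Bin.weight_mk, hx, weight_of_c h₁ h₂, hγ]
  | b =>
    obtain ⟨x, hx, h₁, h₂⟩ := h
    simp only at hx
    simp [Bin.weight_mk, hx, weight_of_b h₁ h₂]
  | a₁ =>
    obtain ⟨x, hx, h₁, h₂⟩ := h
    simp only at hx
    simp [Bin.weight_mk, hx, weight_of_a h₁ h₂, hα]
  | a₂ =>
    obtain ⟨x, hx, h₁, h₂⟩ := h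
    simp only at hx
    simp [Bin.weight_mk, hx, weight_of_a h₁ h₂, hα]
  | nextFit k =>
    obtain ⟨hk, -, h⟩ := h
    refine List.sum_nonneg fun w hw => ?_
    obtain ⟨x, hx, rfl⟩ := List.mem_map.1 hw
    refine _root_.weight_nonneg hα hγ ?_
    rcases (h x hx).1.small hk (h x hx).2 with ⟨-, h, -⟩ | ⟨-, h, -⟩
    exacts [lt_trans (by positivity) h, h]
  | _ => simp only [Bin.Sound] at h; linarith

/-- The number of bins, bounded by the total weight and the numbers of bins of certain types. -/
theorem length_le_of_forall {α γ β ρ δ : ℝ} (s : List Bin)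
    (h : ∀ B ∈ s, 1 ≤ B.weight α γ + β * (if B.kind.isBlue then 1 else 0) +
      ρ * (if B.kind.isRed then 1 else 0) + (1 - δ) * (if B.kind.isC then 1 else 0) +
      δ * (if B.kind.isA₁ then 1 else 0) + (if B.kind.isB then 1 else 0) +
      (if B.kind.isA₂ then 1 else 0) +
      ∑ k ∈ Finset.range 20, (if B.kind.isNextFit k then 1 else 0)) :
    (s.length : ℝ) ≤ (s.map (Bin.weight α γ)).sum + β * numBins Kind.isBlue s +
      ρ * numBins Kind.isRed s + (1 - δ) * numBins Kind.isC s + δ * numBins Kind.isA₁ s +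
      numBins Kind.isB s + numBins Kind.isA₂ s +
      ∑ k ∈ Finset.range 20, (numBins (Kind.isNextFit k) s : ℝ) := by
  induction s with
  | nil => simp [numBins_nil]
  | cons B s ih =>
    have ih := ih fun C hC => h C (by simp [hC])
    have hB := h B (by simp)
    simp only [numBins_cons, List.length_cons, List.map_cons, List.sum_cons]
    push_cast
    rw [Finset.sum_add_distrib]
    linarith

/-- Each bin's weight is corrected by a charge for its type to reach 1: `β` for blue and `ρ` for red
bins, either of which may be negative, and a full unit for the boundedly many unfinished bins. The
parameter `δ` decides whether lone `c` bins (`δ = 0`) or lone `a₁`-bins (`δ = 1`) receive a further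
unit; it is set so that the bins charged are the absent ones. -/
theorem Bin.Sound.one_le {α γ : ℝ} (hα : 0 ≤ α) (hγ : 0 ≤ γ) {β ρ δ : ℝ}
    (hac : 1 ≤ α + γ + β) (hbc : 1 ≤ γ + 1 / 2 + β) (haa : 1 ≤ 2 * α + ρ) (hc : δ ≤ γ)
    (ha₁ : 1 ≤ α + β + δ) (hρ : 0 ≤ α + ρ) {B : Bin} (hB : B.Sound α γ) :
    1 ≤ B.weight α γ + β * (if B.kind.isBlue then 1 else 0) +
      ρ * (if B.kind.isRed then 1 else 0) + (1 - δ) * (if B.kind.isC then 1 else 0) +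
      δ * (if B.kind.isA₁ then 1 else 0) + (if B.kind.isB then 1 else 0) +
      (if B.kind.isA₂ then 1 else 0) +
      ∑ k ∈ Finset.range 20, (if B.kind.isNextFit k then 1 else 0) := by
  have hnn := hB.weight_nonneg hα hγ
  obtain ⟨l, k⟩ := B
  cases k with
  | c =>
    obtain ⟨x, hx, h₁, h₂⟩ := hB
    simp only at hx
    simp [Kind.isBlue, Kind.isRed, Kind.isC, Kind.isA₁, Kind.isB, Kind.isA₂, Kind.isNextFit,
      Bin.weight_mk, hx, weight_of_c h₁ h₂]
    linarith
  | a₁ =>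
    obtain ⟨x, hx, h₁, h₂⟩ := hB
    simp only at hx
    simp [Kind.isBlue, Kind.isRed, Kind.isC, Kind.isA₁, Kind.isB, Kind.isA₂, Kind.isNextFit,
      Bin.weight_mk, hx, weight_of_a h₁ h₂]
    linarith
  | a₂ =>
    obtain ⟨x, hx, h₁, h₂⟩ := hB
    simp only at hx
    simp [Kind.isBlue, Kind.isRed, Kind.isC, Kind.isA₁, Kind.isB, Kind.isA₂, Kind.isNextFit,
      Bin.weight_mk, hx, weight_of_a h₁ h₂]
    linarith
  | nextFit k =>
    have hk : k < 20 := by have := hB.2.1; omega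
    simp [Kind.isBlue, Kind.isRed, Kind.isC, Kind.isA₁, Kind.isB, Kind.isA₂, Kind.isNextFit, hk]
    linarith
  | _ =>
    simp only [Bin.Sound] at hB
    simp [Kind.isBlue, Kind.isRed, Kind.isC, Kind.isA₁, Kind.isB, Kind.isA₂, Kind.isNextFit]
    linarith

/-- Refined Harmonic Match opens at most `373 / 228 * opt σ + 23` bins. -/
theorem rhm_le (τ : TieBreak) {σ : List ℝ} (hσ : IsInstance σ) :
    (rhm τ σ : ℝ) ≤ 373 / 228 * (opt σ : ℝ) + 23 := by
  have key {α γ : ℝ} (β ρ δ : ℝ) (hα : 0 ≤ α) (hγ : 0 ≤ γ) (hα' : α ≤ 4 / 7) (hγ' : γ ≤ 1)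
      (hαγ : α + γ ≤ 10 / 7)
      (hac : 1 ≤ α + γ + β) (hbc : 1 ≤ γ + 1 / 2 + β) (haa : 1 ≤ 2 * α + ρ) (hc : δ ≤ γ)
      (ha₁ : 1 ≤ α + β + δ) (hρ : 0 ≤ α + ρ) :
      (rhm τ σ : ℝ) ≤ 373 / 228 * (opt σ : ℝ) + β * numBins Kind.isBlue (rhmPacking τ σ) +
        ρ * numBins Kind.isRed (rhmPacking τ σ) +
        (1 - δ) * numBins Kind.isC (rhmPacking τ σ) +
        δ * numBins Kind.isA₁ (rhmPacking τ σ) + 22 := by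
    have h := invariant_rhmPacking hα hγ τ hσ
    have hlen := length_le_of_forall _ fun B hB =>
      (h.sound B hB).one_le hα hγ hac hbc haa hc ha₁ hρ
    have hopt := sum_weight_le_opt hα' hγ' hαγ hσ
    have hb : (numBins Kind.isB (rhmPacking τ σ) : ℝ) ≤ 1 := by exact_mod_cast h.balanced.b_le
    have ha : (numBins Kind.isA₂ (rhmPacking τ σ) : ℝ) ≤ 1 := by exact_mod_cast h.balanced.a₂_le
    -- The additive 22 consists of at most 20 Next Fit bins, one lone `b` bin and one lone `a₂`-bin.
    have hnf : ∑ k ∈ Finset.range 20, (numBins (Kind.isNextFit k) (rhmPacking τ σ) : ℝ) ≤ 20 := by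
      have := Finset.sum_le_card_nsmul (Finset.range 20)
        (fun k => (numBins (Kind.isNextFit k) (rhmPacking τ σ) : ℝ)) 1
        fun k _ => by exact_mod_cast h.balanced.nextFit_le k
      simpa using this
    rw [h.total] at hlen
    rw [rhm]
    linarith
  -- The bin counts do not depend on the weights, so any admissible `α`, `γ` will do here.
  have hbal := (invariant_rhmPacking (α := 0) (γ := 0) le_rfl le_rfl τ hσ).balanced
  by_cases hA : numBins Kind.isA₁ (rhmPacking τ σ) = 0
  -- With these values bins of types `ac` and `aa` come out at exactly 1, and the correction is (red
  -- - 3·blue)/7 ≤ 0.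
  · have hk := key (α := 3 / 7) (γ := 1) (-3 / 7) (1 / 7) 1 (by norm_num) (by norm_num)
      (by norm_num) (by norm_num) (by norm_num) (by norm_num) (by norm_num) (by norm_num)
      (by norm_num) (by norm_num) (by norm_num)
    have hr : (numBins Kind.isRed (rhmPacking τ σ) : ℝ) ≤
        3 * numBins Kind.isBlue (rhmPacking τ σ) := by exact_mod_cast hbal.red_le
    rw [hA] at hk
    push_cast at hk
    linarith
  -- Now bins of types `bc`, `aa` and `a₁` come out at exactly 1, and the correction (3·blue -
  -- red)/7 is at most 3/7, which is rounded up to 1 in the constant 23.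
  · have hk := key (α := 4 / 7) (γ := 1 / 14) (3 / 7) (-1 / 7) 0 (by norm_num) (by norm_num)
      (by norm_num) (by norm_num) (by norm_num) (by norm_num) (by norm_num) (by norm_num)
      (by norm_num) (by norm_num) (by norm_num)
    have hr : (3 * numBins Kind.isBlue (rhmPacking τ σ) : ℝ) ≤
        numBins Kind.isRed (rhmPacking τ σ) + 3 := by
      exact_mod_cast hbal.blue_le.resolve_left hA
    rw [hbal.c_or_a₁.resolve_right hA] at hk
    push_cast at hk
    linarith

/-! ### From the additive bound to the asymptotic ratio. -/

/-- An algorithm with `A σ ≤ r * opt σ + C` has asymptotic ratio at most `r`. -/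
theorem asymptoticRatio_le {A : List ℝ → ℕ} {r C : ℝ}
    (h : ∀ σ, IsInstance σ → (A σ : ℝ) ≤ r * (opt σ : ℝ) + C) :
    asymptoticRatio A ≤ ENNReal.ofReal r := by
  have hlim : Filter.Tendsto (fun n : ℕ => ENNReal.ofReal (r + C / n)) Filter.atTop
      (nhds (ENNReal.ofReal r)) := by
    refine ENNReal.tendsto_ofReal ?_
    simpa using tendsto_const_nhds.add (tendsto_const_div_atTop_nhds_zero_nat C)
  rw [← hlim.limsup_eq, asymptoticRatio]
  refine Filter.limsup_le_limsup ?_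
  filter_upwards [Filter.eventually_gt_atTop 0] with n hn
  refine iSup₂_le ?_
  rintro σ ⟨hσ, rfl⟩
  have hn' : (0 : ℝ) < opt σ := by exact_mod_cast hn
  rw [← ENNReal.ofReal_natCast (A σ), ← ENNReal.ofReal_natCast (opt σ),
    ← ENNReal.ofReal_div_of_pos hn']
  refine ENNReal.ofReal_le_ofReal ?_
  rw [div_le_iff₀ hn', add_mul, div_mul_cancel₀ _ hn'.ne']
  exact h σ hσ

theorem theorem3 :
    (∀ τ : TieBreak, asymptoticRatio (rhm τ) ≤ ENNReal.ofReal (373 / 228)) ∧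
    (∃ C : ℝ, ∀ τ : TieBreak, ∀ σ : List ℝ, IsInstance σ →
      (rhm τ σ : ℝ) ≤ 373 / 228 * (opt σ : ℝ) + C) ∧
    (373 / 228 : ℝ) < 1.636 :=
  ⟨fun τ => asymptoticRatio_le fun _ hσ => rhm_le τ hσ, ⟨23, fun τ _ hσ => rhm_le τ hσ⟩,
    by norm_num⟩
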